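/- Let $T>0$. Let $g:\mathbb{R}\to\mathbb{R}$ be a continuous odd function that is sublinear, i.e. $g(x)/x\to 0$ as $|x|\to\infty$, and let $k:\mathbb{R}\to\mathbb{R}$ be a continuous, odd, $T$-periodic function with $\int_0^T k(t)\,dt=0$. Then the equation $$u''+g(u)=k(t)$$ has an odd $T$-periodic solution $u\in C^2(\mathbb{R})$, and the set of all its odd $T$-periodic $C^2$ solutions is bounded in the sup norm: there is $R$ with $|u(t)|\le R$ for every such solution $u$ and every $t\in\mathbb{R}$. Moreover, let $\mathcal{H}$ be the space of continuous, odd, $T$-periodic functions $\mathbb{R}\to\mathbb{R}$ with the sup norm, let $L:\mathcal{H}\cap C^2(\mathbb{R})\to\mathcal{H}$, $Lu=u''$ (a linear bijection), and let $N:\mathcal{H}\to\mathcal{H}$, $Nu=k-g(u)$. Then the set $$\Sigma=\{u\in\mathcal{H} : u=\lambda L^{-1}Nu \text{ for some } \lambda\in(0,1]\}$$ is bounded in the sup norm. -/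

import Mathlib

open scoped Topology

noncomputable section

/-- `g` is sublinear: `g x / x → 0` as `|x| → ∞`. -/
def Sublinear (g : ℝ → ℝ) : Prop :=
  Filter.Tendsto (fun x => g x / x) (Filter.cocompact ℝ) (𝓝 0)

/-- The space `H` of continuous, odd, `T`-periodic real functions on the line. -/
def oddPeriodic (T : ℝ) : Submodule ℝ (ℝ → ℝ) where
  carrier := {u | Continuous u ∧ Function.Periodic u T ∧ Function.Odd u}
  zero_mem' := ⟨continuous_const, fun _ => rfl, fun _ => by simp⟩
  add_mem' := fun ha hb => ⟨ha.1.add hb.1, ha.2.1.add hb.2.1, ha.2.2.add hb.2.2⟩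
  smul_mem' := fun c _ ha => ⟨ha.1.const_smul c, ha.2.1.smul c, ha.2.2.const_smul c⟩

/-- The domain of `L` in `H`: the twice continuously differentiable members of `H`. -/
def domL (T : ℝ) : Submodule ℝ (oddPeriodic T) where
  carrier := {u | ContDiff ℝ 2 (u : ℝ → ℝ)}
  zero_mem' := (contDiff_const : ContDiff ℝ 2 fun _ : ℝ => (0 : ℝ))
  add_mem' := fun {u v} (hu : ContDiff ℝ 2 (u : ℝ → ℝ)) (hv : ContDiff ℝ 2 (v : ℝ → ℝ)) =>
    (hu.add hv : ContDiff ℝ 2 fun t => (u : ℝ → ℝ) t + (v : ℝ → ℝ) t)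
  smul_mem' := fun c u (hu : ContDiff ℝ 2 (u : ℝ → ℝ)) =>
    (hu.const_smul c : ContDiff ℝ 2 fun t => c • (u : ℝ → ℝ) t)

theorem contDiff_two_data {u : ℝ → ℝ} (hu : ContDiff ℝ 2 u) :
    Differentiable ℝ u ∧ Differentiable ℝ (deriv u) ∧ Continuous (deriv (deriv u)) := by
  have h1 : ContDiff ℝ (1 + 1) u := by
    have h : (1 + 1 : WithTop ℕ∞) = 2 := by norm_num
    rwa [h]
  have h2 := (contDiff_succ_iff_deriv.1 h1).2.2
  have h3 := contDiff_one_iff_deriv.1 h2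
  exact ⟨(contDiff_succ_iff_deriv.1 h1).1, h3.1, h3.2⟩

theorem deriv_periodic {u : ℝ → ℝ} {T : ℝ} (hu : Function.Periodic u T) :
    Function.Periodic (deriv u) T := by
  intro t
  rw [← deriv_comp_add_const, show (fun x => u (x + T)) = u from funext hu]

theorem deriv_even_of_odd {u : ℝ → ℝ} (hu : Function.Odd u) : Function.Even (deriv u) := by
  intro t
  have h := deriv_comp_neg u t
  rw [show (fun x => u (-x)) = fun x => -u x from funext hu, deriv.fun_neg] at h
  linarith

theorem deriv_odd_of_even {u : ℝ → ℝ} (hu : Function.Even u) : Function.Odd (deriv u) := by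
  intro t
  have h := deriv_comp_neg u t
  rw [show (fun x => u (-x)) = u from funext hu] at h
  linarith

theorem second_deriv_mem {T : ℝ} (u : domL T) :
    deriv (deriv ((u : oddPeriodic T) : ℝ → ℝ)) ∈ oddPeriodic T :=
  ⟨(contDiff_two_data u.2).2.2, deriv_periodic (deriv_periodic u.1.2.2.1),
    deriv_odd_of_even (deriv_even_of_odd u.1.2.2.2)⟩

/-- The operator `L u = u''` from `dom(L) ∩ H` to `H`. -/
def opL (T : ℝ) : domL T →ₗ[ℝ] oddPeriodic T where
  toFun u := ⟨deriv (deriv ((u : oddPeriodic T) : ℝ → ℝ)), second_deriv_mem u⟩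
  map_add' u v := by
    obtain ⟨hu, hu', -⟩ := contDiff_two_data u.2
    obtain ⟨hv, hv', -⟩ := contDiff_two_data v.2
    have h1 : deriv (((u + v : domL T) : oddPeriodic T) : ℝ → ℝ)
        = deriv ((u : oddPeriodic T) : ℝ → ℝ) + deriv ((v : oddPeriodic T) : ℝ → ℝ) :=
      funext fun t => deriv_add (hu t) (hv t)
    apply Subtype.ext
    change deriv (deriv (((u + v : domL T) : oddPeriodic T) : ℝ → ℝ)) = _
    rw [h1]
    exact funext fun t => deriv_add (hu' t) (hv' t)
  map_smul' c u := by
    obtain ⟨hu, hu', -⟩ := contDiff_two_data u.2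
    have h1 : deriv (((c • u : domL T) : oddPeriodic T) : ℝ → ℝ)
        = c • deriv ((u : oddPeriodic T) : ℝ → ℝ) :=
      funext fun t => deriv_const_smul c (hu t)
    apply Subtype.ext
    change deriv (deriv (((c • u : domL T) : oddPeriodic T) : ℝ → ℝ)) = _
    rw [h1]
    exact funext fun t => deriv_const_smul c (hu' t)

theorem opL_injective {T : ℝ} (hT : 0 < T) : Function.Injective (opL T) := by
  rw [injective_iff_map_eq_zero]
  intro u hu
  obtain ⟨hd, hd', -⟩ := contDiff_two_data u.2
  have h2 : ∀ t, deriv (deriv ((u : oddPeriodic T) : ℝ → ℝ)) t = 0 := fun t =>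
    congrFun (congrArg Subtype.val hu) t
  have h1 : ∀ t, deriv ((u : oddPeriodic T) : ℝ → ℝ) t
      = deriv ((u : oddPeriodic T) : ℝ → ℝ) 0 := fun t => is_const_of_deriv_eq_zero hd' h2 t 0
  set c := deriv ((u : oddPeriodic T) : ℝ → ℝ) 0 with hc
  have h0 : ((u : oddPeriodic T) : ℝ → ℝ) 0 = 0 := u.1.2.2.2.map_zero
  have hlin : ∀ t, ((u : oddPeriodic T) : ℝ → ℝ) t = c * t := by
    intro t
    have hdd : ∀ s, HasDerivAt (fun s => ((u : oddPeriodic T) : ℝ → ℝ) s - c * s) 0 s := by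
      intro s
      have := (hd s).hasDerivAt.sub ((hasDerivAt_id s).const_mul c)
      rw [h1 s, mul_one, sub_self] at this
      exact this
    have := is_const_of_deriv_eq_zero (fun s => (hdd s).differentiableAt)
      (fun s => (hdd s).deriv) t 0
    simp only [h0] at this
    linarith
  have hcT : c * T = 0 := by
    have := u.1.2.2.1 0
    rw [zero_add, h0, hlin T] at this
    exact this
  have hc0 : c = 0 := (mul_eq_zero.1 hcT).resolve_right hT.ne'
  apply Subtype.ext
  apply Subtype.ext
  funext t
  rw [hlin t, hc0, zero_mul]
  rfl

theorem primitive_periodic {f : ℝ → ℝ} {T : ℝ} (hf : Continuous f) (hp : Function.Periodic f T)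
    (h0 : ∫ s in (0 : ℝ)..T, f s = 0) : Function.Periodic (fun t => ∫ s in (0 : ℝ)..t, f s) T := by
  intro t
  have h1 := hp.intervalIntegral_add_eq t 0
  rw [zero_add, h0] at h1
  have h2 := intervalIntegral.integral_add_adjacent_intervals
    (hf.intervalIntegrable (μ := MeasureTheory.volume) 0 t) (hf.intervalIntegrable t (t + T))
  simp only
  linarith

theorem primitive_neg (f : ℝ → ℝ) (t : ℝ) :
    ∫ s in (0 : ℝ)..(-t), f s = -∫ s in (0 : ℝ)..t, f (-s) := by
  rw [intervalIntegral.integral_comp_neg, neg_zero, intervalIntegral.integral_symm]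

theorem integral_odd_periodic {f : ℝ → ℝ} {T : ℝ} (hp : Function.Periodic f T)
    (ho : Function.Odd f) : ∫ s in (0 : ℝ)..T, f s = 0 := by
  have h1 := hp.intervalIntegral_add_eq (-T) 0
  rw [zero_add, neg_add_cancel, intervalIntegral.integral_symm, primitive_neg] at h1
  simp only [ho.eq, intervalIntegral.integral_neg] at h1
  linarith

theorem opL_surjective {T : ℝ} (hT : 0 < T) : Function.Surjective (opL T) := by
  rintro ⟨f, hfc, hfp, hfo⟩
  set F : ℝ → ℝ := fun t => ∫ s in (0 : ℝ)..t, f s with hF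
  have hFd : ∀ t, HasDerivAt F (f t) t := fun t => hfc.integral_hasStrictDerivAt 0 t |>.hasDerivAt
  have hFc : Continuous F := continuous_iff_continuousAt.2 fun t => (hFd t).continuousAt
  have hFp : Function.Periodic F T := primitive_periodic hfc hfp (integral_odd_periodic hfp hfo)
  have hFe : Function.Even F := by
    intro t
    simp only [hF, primitive_neg, hfo.eq, intervalIntegral.integral_neg, neg_neg]
  set c : ℝ := (∫ s in (0 : ℝ)..T, F s) / T with hc
  set K : ℝ → ℝ := fun t => F t - c with hK
  have hKd : ∀ t, HasDerivAt K (f t) t := fun t => (hFd t).sub_const c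
  have hKc : Continuous K := hFc.sub continuous_const
  have hKp : Function.Periodic K T := fun t => by simp only [hK, hFp t]
  have hK0 : ∫ s in (0 : ℝ)..T, K s = 0 := by
    simp only [hK]
    rw [intervalIntegral.integral_sub (hFc.intervalIntegrable _ _)
      (continuous_const.intervalIntegrable _ _), intervalIntegral.integral_const, hc]
    simp only [sub_zero, smul_eq_mul]
    field_simp
    ring
  set G : ℝ → ℝ := fun t => ∫ s in (0 : ℝ)..t, K s with hG
  have hGd : ∀ t, HasDerivAt G (K t) t := fun t => hKc.integral_hasStrictDerivAt 0 t |>.hasDerivAt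
  have hGc : Continuous G := continuous_iff_continuousAt.2 fun t => (hGd t).continuousAt
  have hGp : Function.Periodic G T := primitive_periodic hKc hKp hK0
  have hGo : Function.Odd G := by
    intro t
    simp only [hG, primitive_neg, hK, hFe.eq]
  have hdG : deriv G = K := funext fun t => (hGd t).deriv
  have hdK : deriv K = f := funext fun t => (hKd t).deriv
  have hG2 : ContDiff ℝ 2 G := by
    have h : (2 : WithTop ℕ∞) = 1 + 1 := by norm_num
    rw [h, contDiff_succ_iff_deriv]
    refine ⟨fun t => (hGd t).differentiableAt, by simp, ?_⟩
    rw [hdG, contDiff_one_iff_deriv, hdK]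
    exact ⟨fun t => (hKd t).differentiableAt, hfc⟩
  refine ⟨⟨⟨G, hGc, hGp, hGo⟩, hG2⟩, Subtype.ext ?_⟩
  change deriv (deriv G) = f
  rw [hdG, hdK]

/-- The inverse `L⁻¹ : H → dom(L) ∩ H` of the bijective operator `L`. -/
def invL (T : ℝ) (hT : 0 < T) : oddPeriodic T ≃ₗ[ℝ] domL T :=
  (LinearEquiv.ofBijective (opL T) ⟨opL_injective hT, opL_surjective hT⟩).symm

/-- The nonlinear part `N u = k - g(u)`, as a map from `H` to `H`. -/
def opN {T : ℝ} (g : ℝ → ℝ) (hg : Continuous g) (hgo : Function.Odd g) (k u : oddPeriodic T) :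
    oddPeriodic T :=
  ⟨fun t => (k : ℝ → ℝ) t - g ((u : ℝ → ℝ) t),
    k.2.1.sub (hg.comp u.2.1),
    fun t => by simp only [k.2.2.1 t, u.2.2.1 t],
    fun t => by simp only [k.2.2.2 t, u.2.2.2 t, hgo _]; ring⟩

/-- The set `{u ∈ H : u = λ L⁻¹ N u for some λ ∈ (0, 1]}`. -/
def schaeferSet {T : ℝ} (hT : 0 < T) (g : ℝ → ℝ) (hg : Continuous g) (hgo : Function.Odd g)
    (k : oddPeriodic T) : Set (oddPeriodic T) :=
  {u | ∃ lam ∈ Set.Ioc (0 : ℝ) 1, u = lam • (invL T hT (opN g hg hgo k u) : oddPeriodic T)}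

/-- `u` is an odd, `T`-periodic (classical) solution of `u'' + g(u) = k(t)`. -/
structure IsOddPeriodicSolution (T : ℝ) (g k u : ℝ → ℝ) : Prop where
  contDiff : ContDiff ℝ 2 u
  odd : Function.Odd u
  periodic : Function.Periodic u T
  eqn : ∀ t, deriv (deriv u) t + g (u t) = k t

end

/-!
The a priori bounds rest on sublinearity in the form `|g x| ≤ δ |x| + C` with `δ` as small as
desired. An odd `T`-periodic `u` vanishes at `0` and, by Rolle, has a critical point in `(0, T)`, so
`sup |u| ≤ T² sup |u''|`. If `u'' = lam (k - g u)` with `lam ∈ (0, 1]`, then for `δ = 1 / (2 T²)`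
half of `sup |u|` is absorbed into the left-hand side. The solutions of the equation
(`lam = 1`) and the members of `schaeferSet` are covered together, by
`exists_bound_of_deriv_deriv_eq_smul`.

For existence, put `S = T / 2`. Odd `T`-periodic functions vanish at `0` and at `S`, and a solution
of the Dirichlet problem on `[0, S]` extends oddly and periodically. The Dirichlet problem is solved
by shooting. Since `g` is only continuous, the initial value problem need not be well posed, so
`g (u t)` is first replaced by the delayed term `g (u (max (t - ε) 0))`. The Picard iterates of the
delayed problem become stationary on `[0, S]` after finitely many steps, and hence give a solution
that depends continuously on the slope `a = u' 0` (`exists_delay_family`). Sublinearity makes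
`u S` have the sign of `a` for `|a|` large, uniformly in `ε`, and the intermediate value theorem
yields a slope with `u S = 0` (`exists_delay_dirichlet`). The solutions so obtained are uniformly
bounded and uniformly Lipschitz, and by Arzelà-Ascoli and dominated convergence a subsequence
converges, as `ε → 0`, to a solution of the Dirichlet problem (`exists_dirichlet`).

Smoothness of the extension `U` across the points of `S ℤ` comes from the surjectivity of `opL`:
there is a `C²` odd periodic `w` with `w'' = k - g U`, and `U - w` is affine on `[0, S]` and vanishes
at both ends, so `U = w`.
-/

/-! ### A priori bounds -/

theorem Sublinear.exists_abs_le {g : ℝ → ℝ} (hg : Sublinear g) (hgc : Continuous g) {δ : ℝ}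
    (hδ : 0 < δ) : ∃ C, 0 ≤ C ∧ ∀ x, |g x| ≤ δ * |x| + C := by
  have h := hg.eventually (Metric.ball_mem_nhds (0 : ℝ) hδ)
  obtain ⟨K, hK, hKs⟩ := Filter.mem_cocompact.1 h
  obtain ⟨C, hC⟩ := (hK.union (isCompact_singleton (x := (0 : ℝ)))).exists_bound_of_continuousOn
    hgc.continuousOn
  refine ⟨max C 0, le_max_right _ _, fun x => ?_⟩
  by_cases hx : x ∈ K ∪ {0}
  · have := hC x hx
    rw [Real.norm_eq_abs] at this
    have h1 : 0 ≤ δ * |x| := by positivity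
    linarith [le_max_left C 0]
  · simp only [Set.mem_union, Set.mem_singleton_iff, not_or] at hx
    have h1 : g x / x ∈ Metric.ball (0 : ℝ) δ := hKs hx.1
    rw [mem_ball_zero_iff, Real.norm_eq_abs, abs_div, div_lt_iff₀ (abs_pos.2 hx.2)] at h1
    linarith [le_max_right C 0]

theorem Function.Periodic.exists_abs_le {f : ℝ → ℝ} {T : ℝ} (hp : Function.Periodic f T)
    (hT : 0 < T) (hf : Continuous f) : ∃ C, 0 ≤ C ∧ ∀ t, |f t| ≤ C := by
  obtain ⟨C, hC⟩ := isCompact_Icc.exists_bound_of_continuousOn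
    (s := Set.Icc (0 : ℝ) T) hf.continuousOn
  have h : ∀ t, |f t| ≤ C := by
    intro t
    obtain ⟨y, hy, hty⟩ := hp.exists_mem_Ico₀ hT t
    rw [hty]
    exact hC y ⟨hy.1, hy.2.le⟩
  exact ⟨C, (abs_nonneg _).trans (h 0), h⟩

/-- By Rolle, `u'` vanishes somewhere in `(0, T)`, so `|u'| ≤ B T` on `[0, T]`; integrate once more
from `u 0 = 0`. -/
theorem abs_le_of_abs_deriv_deriv_le {u : ℝ → ℝ} {T B : ℝ} (hT : 0 < T) (hu : ContDiff ℝ 2 u)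
    (hp : Function.Periodic u T) (ho : Function.Odd u) (hB : ∀ t, |deriv (deriv u) t| ≤ B)
    (t : ℝ) : |u t| ≤ B * T * T := by
  obtain ⟨hd, hd', -⟩ := contDiff_two_data hu
  have hB0 : 0 ≤ B := (abs_nonneg _).trans (hB 0)
  obtain ⟨ξ, hξ, hξ0⟩ := exists_deriv_eq_zero (f := u) hT hu.continuous.continuousOn
    (by simpa using (hp 0).symm)
  have h1 : ∀ s ∈ Set.Icc 0 T, ‖deriv u s‖ ≤ B * T := by
    intro s hs
    have := convex_univ.norm_image_sub_le_of_norm_deriv_le (f := deriv u) (C := B) (x := ξ) (y := s)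
      (fun x _ => hd' x) (fun x _ => hB x) trivial trivial
    rw [hξ0, sub_zero] at this
    refine this.trans (mul_le_mul_of_nonneg_left ?_ hB0)
    rw [Real.norm_eq_abs, abs_le]
    constructor <;> linarith [hs.1, hs.2, hξ.1, hξ.2]
  obtain ⟨y, hy, hty⟩ := hp.exists_mem_Ico₀ hT t
  rw [hty]
  have := (convex_Icc 0 T).norm_image_sub_le_of_norm_deriv_le (f := u) (x := 0) (y := y)
      (fun x _ => hd x) h1 ⟨le_rfl, hT.le⟩ ⟨hy.1, hy.2.le⟩
  rw [ho.map_zero, sub_zero, sub_zero, Real.norm_eq_abs, Real.norm_eq_abs, abs_of_nonneg hy.1]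
    at this
  exact this.trans (mul_le_mul_of_nonneg_left hy.2.le (by positivity))

/-- A single bound for the odd `T`-periodic solutions of all the equations
`u'' = lam (k - g u)`, `0 < lam ≤ 1`. -/
theorem exists_bound_of_deriv_deriv_eq_smul {T : ℝ} (hT : 0 < T) {g : ℝ → ℝ} (hgc : Continuous g)
    (hgs : Sublinear g) {k : ℝ → ℝ} (hkc : Continuous k) (hkp : Function.Periodic k T) :
    ∃ R : ℝ, ∀ u : ℝ → ℝ, ContDiff ℝ 2 u → Function.Periodic u T → Function.Odd u →
      ∀ lam ∈ Set.Ioc (0 : ℝ) 1, (∀ t, deriv (deriv u) t = lam * (k t - g (u t))) →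
      ∀ t, |u t| ≤ R := by
  -- This `δ` turns the term `δ * sup |u| * T * T` of the estimate into `sup |u| / 2`.
  obtain ⟨C, hC0, hC⟩ := hgs.exists_abs_le hgc (δ := 1 / (2 * T * T)) (by positivity)
  obtain ⟨K, hK0, hK⟩ := hkp.exists_abs_le hT hkc
  refine ⟨2 * ((K + C) * T * T), fun u hu hp ho lam hlam he t => ?_⟩
  obtain ⟨y, hy, hmax⟩ := (isCompact_Icc (a := (0 : ℝ)) (b := T)).exists_isMaxOn
    ⟨0, le_rfl, hT.le⟩ (hu.continuous.abs.continuousOn)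
  have hle : ∀ t, |u t| ≤ |u y| := by
    intro t
    obtain ⟨z, hz, htz⟩ := hp.exists_mem_Ico₀ hT t
    rw [htz]
    exact hmax ⟨hz.1, hz.2.le⟩
  have hB : ∀ t, |deriv (deriv u) t| ≤ K + (1 / (2 * T * T) * |u y| + C) := by
    intro t
    rw [he, abs_mul, abs_of_pos hlam.1]
    have h1 : |k t - g (u t)| ≤ K + (1 / (2 * T * T) * |u y| + C) := by
      refine (abs_sub _ _).trans (add_le_add (hK t) ((hC _).trans ?_))
      exact add_le_add_left (mul_le_mul_of_nonneg_left (hle t) (by positivity)) C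
    exact (mul_le_of_le_one_left (abs_nonneg _) hlam.2).trans h1
  have h2 := abs_le_of_abs_deriv_deriv_le hT hu hp ho hB y
  have h3 : (K + (1 / (2 * T * T) * |u y| + C)) * T * T = (K + C) * T * T + |u y| / 2 := by
    field_simp
    ring
  rw [h3] at h2
  linarith [hle t]

theorem deriv_deriv_of_mem_schaeferSet {T : ℝ} {hT : 0 < T} {g : ℝ → ℝ} {hg : Continuous g}
    {hgo : Function.Odd g} {k u : oddPeriodic T} (hu : u ∈ schaeferSet hT g hg hgo k) :
    ContDiff ℝ 2 (u : ℝ → ℝ) ∧ ∃ lam ∈ Set.Ioc (0 : ℝ) 1, ∀ t,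
      deriv (deriv (u : ℝ → ℝ)) t = lam * ((k : ℝ → ℝ) t - g ((u : ℝ → ℝ) t)) := by
  obtain ⟨lam, hlam, he⟩ := hu
  set v := invL T hT (opN g hg hgo k u) with hv
  have hLv : opL T v = opN g hg hgo k u :=
    (LinearEquiv.ofBijective (opL T) ⟨opL_injective hT, opL_surjective hT⟩).apply_symm_apply _
  have hLu : opL T (lam • v) = lam • opN g hg hgo k u := by rw [map_smul, hLv]
  have hcoe : ((lam • v : domL T) : oddPeriodic T) = u := he.symm
  refine ⟨hcoe ▸ (lam • v).2, lam, hlam, fun t => ?_⟩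
  have h := congrFun (congrArg Subtype.val hLu) t
  change deriv (deriv (((lam • v : domL T) : oddPeriodic T) : ℝ → ℝ)) t = _ at h
  rw [hcoe] at h
  exact h

/-! ### Double primitives -/

/-- The solution of `u'' = f` with `u 0 = 0` and `u' 0 = a`, as an iterated integral. -/
noncomputable def doublePrimitive (a : ℝ) (f : ℝ → ℝ) (t : ℝ) : ℝ :=
  ∫ s in (0 : ℝ)..t, (a + ∫ r in (0 : ℝ)..s, f r)

theorem continuous_const_add_primitive (a : ℝ) {f : ℝ → ℝ} (hf : Continuous f) :
    Continuous fun s => a + ∫ r in (0 : ℝ)..s, f r :=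
  continuous_const.add (intervalIntegral.continuous_primitive
    (fun x y => hf.intervalIntegrable x y) 0)

theorem doublePrimitive_zero (a : ℝ) (f : ℝ → ℝ) : doublePrimitive a f 0 = 0 :=
  intervalIntegral.integral_same

theorem hasDerivAt_doublePrimitive (a : ℝ) {f : ℝ → ℝ} (hf : Continuous f) (t : ℝ) :
    HasDerivAt (doublePrimitive a f) (a + ∫ r in (0 : ℝ)..t, f r) t :=
  ((continuous_const_add_primitive a hf).integral_hasStrictDerivAt 0 t).hasDerivAt

theorem doublePrimitive_congr {a t : ℝ} {f f' : ℝ → ℝ} (ht : 0 ≤ t)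
    (h : ∀ s ∈ Set.Icc 0 t, f s = f' s) : doublePrimitive a f t = doublePrimitive a f' t := by
  refine intervalIntegral.integral_congr fun s hs => ?_
  rw [Set.uIcc_of_le ht] at hs
  refine congrArg (a + ·) (intervalIntegral.integral_congr fun r hr => ?_)
  rw [Set.uIcc_of_le hs.1] at hr
  exact h r ⟨hr.1, hr.2.trans hs.2⟩

theorem abs_primitive_le {f : ℝ → ℝ} {S B s : ℝ} (hB : ∀ r ∈ Set.Icc 0 S, |f r| ≤ B)
    (hs : s ∈ Set.Icc 0 S) : |∫ r in (0 : ℝ)..s, f r| ≤ B * S := by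
  have hB0 : 0 ≤ B := (abs_nonneg _).trans (hB s hs)
  have h := intervalIntegral.norm_integral_le_of_norm_le_const (a := 0) (b := s) (f := f) (C := B)
    (fun r hr => by
      rw [Set.uIoc_of_le hs.1] at hr
      exact hB r ⟨hr.1.le, hr.2.trans hs.2⟩)
  rw [sub_zero, abs_of_nonneg hs.1] at h
  exact h.trans (mul_le_mul_of_nonneg_left hs.2 hB0)

theorem abs_doublePrimitive_sub_mul_le {a : ℝ} {f : ℝ → ℝ} (hf : Continuous f) {S B t : ℝ}
    (hB : ∀ r ∈ Set.Icc 0 S, |f r| ≤ B) (ht : t ∈ Set.Icc 0 S) :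
    |doublePrimitive a f t - a * t| ≤ B * S * S := by
  have hc := continuous_const_add_primitive 0 hf
  simp only [zero_add] at hc
  have h : doublePrimitive a f t - a * t = ∫ s in (0 : ℝ)..t, ∫ r in (0 : ℝ)..s, f r := by
    rw [doublePrimitive, intervalIntegral.integral_add intervalIntegrable_const
      (hc.intervalIntegrable _ _), intervalIntegral.integral_const]
    simp only [sub_zero, smul_eq_mul]
    ring
  rw [h]
  exact abs_primitive_le (fun s hs => abs_primitive_le hB hs) ht

theorem abs_doublePrimitive_sub_le {a : ℝ} {f : ℝ → ℝ} (hf : Continuous f) {S B t t' : ℝ}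
    (hB : ∀ r ∈ Set.Icc 0 S, |f r| ≤ B) (ht : t ∈ Set.Icc 0 S) (ht' : t' ∈ Set.Icc 0 S) :
    |doublePrimitive a f t - doublePrimitive a f t'| ≤ (|a| + B * S) * |t - t'| := by
  have := (convex_Icc 0 S).norm_image_sub_le_of_norm_hasDerivWithin_le
    (fun s _ => (hasDerivAt_doublePrimitive a hf s).hasDerivWithinAt)
    (fun s hs => (abs_add_le _ _).trans (add_le_add_right (abs_primitive_le hB hs) |a|)) ht' ht
  exact this

/-! ### The delayed initial value problem -/

/-- Picard iterates for the delayed problem `u''(t) = k(t) - g(u(max (t - ε) 0))`, `u 0 = 0`,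
`u' 0 = a`, in the order: number of steps, slope `a`, time `t`. The truncation `max (t - ε) 0`
keeps the delayed time in `[0, S]`; it amounts to prolonging `u` by `u 0 = 0` to negative times. -/
noncomputable def delayIterate (g k : ℝ → ℝ) (ε : ℝ) : ℕ → ℝ → ℝ → ℝ
  | 0 => fun a t => a * t
  | m + 1 => fun a => doublePrimitive a fun s => k s - g (delayIterate g k ε m a (max (s - ε) 0))

theorem continuous_delayIterate {g k : ℝ → ℝ} (hg : Continuous g) (hk : Continuous k) (ε : ℝ)
    (m : ℕ) : Continuous fun p : ℝ × ℝ => delayIterate g k ε m p.1 p.2 := by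
  induction m with
  | zero => exact continuous_fst.mul continuous_snd
  | succ m ih =>
    have h0 : Continuous (Function.uncurry fun (p : ℝ × ℝ) (s : ℝ) =>
        k s - g (delayIterate g k ε m p.1 (max (s - ε) 0))) := by
      refine (hk.comp continuous_snd).sub (hg.comp (ih.comp (f := fun q : (ℝ × ℝ) × ℝ =>
        (q.1.1, max (q.2 - ε) 0)) ?_))
      fun_prop
    have h1 : Continuous fun p : ℝ × ℝ => p.1 + ∫ r in (0 : ℝ)..p.2,
        (k r - g (delayIterate g k ε m p.1 (max (r - ε) 0))) :=
      continuous_fst.add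
        (intervalIntegral.continuous_parametric_intervalIntegral_of_continuous h0 continuous_snd)
    refine intervalIntegral.continuous_parametric_intervalIntegral_of_continuous
      (f := fun (p : ℝ × ℝ) (s : ℝ) => p.1 + ∫ r in (0 : ℝ)..s,
        (k r - g (delayIterate g k ε m p.1 (max (r - ε) 0)))) ?_ continuous_snd
    exact h1.comp (f := fun q : (ℝ × ℝ) × ℝ => (q.1.1, q.2)) (by fun_prop)

/-- The iterates are stationary on `[0, m ε]` from step `m` on, as the value at time `t` only
involves earlier values up to time `t - ε`. -/
theorem delayIterate_succ_eq (g k : ℝ → ℝ) {ε : ℝ} (hε : 0 ≤ ε) (a : ℝ) (m : ℕ) :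
    ∀ t, 0 ≤ t → t ≤ m * ε → delayIterate g k ε (m + 1) a t = delayIterate g k ε m a t := by
  induction m with
  | zero =>
    intro t h0 h1
    have : t = 0 := le_antisymm (by simpa using h1) h0
    subst this
    simp only [delayIterate, doublePrimitive_zero, mul_zero]
  | succ m ih =>
    intro t h0 h1
    refine doublePrimitive_congr h0 fun s hs => ?_
    rw [ih _ (le_max_right _ _)]
    push_cast at h1
    exact max_le (by linarith [hs.2]) (by positivity)

/-- Solutions of the delayed problem on `[0, S]`, jointly continuous in slope and time. No Lipschitz
condition on `g` is needed. -/
theorem exists_delay_family {g k : ℝ → ℝ} (hg : Continuous g) (hk : Continuous k) {ε : ℝ}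
    (hε : 0 < ε) (S : ℝ) : ∃ u : ℝ → ℝ → ℝ, (Continuous fun p : ℝ × ℝ => u p.1 p.2) ∧
      ∀ a, ∀ t ∈ Set.Icc 0 S,
        u a t = doublePrimitive a (fun s => k s - g (u a (max (s - ε) 0))) t := by
  obtain ⟨m, hm⟩ := exists_nat_ge (S / ε)
  rw [div_le_iff₀ hε] at hm
  exact ⟨delayIterate g k ε m, continuous_delayIterate hg hk ε m, fun a t ht =>
    (delayIterate_succ_eq g k hε.le a m t ht.1 (ht.2.trans hm)).symm⟩

theorem delay_sub_mem {S ε r : ℝ} (hε : 0 ≤ ε) (hr : r ∈ Set.Icc 0 S) :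
    max (r - ε) 0 ∈ Set.Icc 0 S :=
  ⟨le_max_right _ _, max_le (by linarith [hr.2]) (hr.1.trans hr.2)⟩

theorem abs_delay_force_le {g k u : ℝ → ℝ} {S ε δ C K M r : ℝ} (hε : 0 ≤ ε) (hδ : 0 ≤ δ)
    (hC : ∀ x, |g x| ≤ δ * |x| + C) (hK : ∀ t, |k t| ≤ K) (hM : ∀ t ∈ Set.Icc 0 S, |u t| ≤ M)
    (hr : r ∈ Set.Icc 0 S) : |k r - g (u (max (r - ε) 0))| ≤ K + (δ * M + C) := by
  refine (abs_sub _ _).trans (add_le_add (hK r) ((hC _).trans ?_))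
  gcongr
  exact hM _ (delay_sub_mem hε hr)

/-! ### Shooting and the passage to the limit -/

/-- Bounds independent of `ε` for a solution of the delayed problem. Here `M` is the maximum of `|u|`
on `[0, S]`, whose own contribution to the force is absorbed since `δ S² ≤ 1 / 4`. -/
theorem delay_solution_bounds {g k u : ℝ → ℝ} {S ε δ C K a : ℝ} (hS : 0 < S) (hε : 0 ≤ ε)
    (hg : Continuous g) (hk : Continuous k) (hδ : 0 ≤ δ) (hδS : δ * S * S ≤ 1 / 4)
    (hC : ∀ x, |g x| ≤ δ * |x| + C) (hK : ∀ t, |k t| ≤ K) (hu : Continuous u)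
    (he : ∀ t ∈ Set.Icc 0 S, u t = doublePrimitive a (fun s => k s - g (u (max (s - ε) 0))) t) :
    ∃ M, 3 * M ≤ 4 * (|a| * S + (K + C) * S * S) ∧ ∀ t ∈ Set.Icc 0 S, |u t| ≤ M ∧
      |u t - a * t| ≤ (K + C) * S * S + M / 4 := by
  obtain ⟨y, hy, hmax⟩ := (isCompact_Icc (a := (0 : ℝ)) (b := S)).exists_isMaxOn
    ⟨0, le_rfl, hS.le⟩ hu.abs.continuousOn
  have hM : ∀ t ∈ Set.Icc 0 S, |u t| ≤ |u y| := fun t ht => hmax ht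
  have hc : Continuous fun s => k s - g (u (max (s - ε) 0)) := by fun_prop
  have hd : ∀ t ∈ Set.Icc 0 S, |u t - a * t| ≤ (K + C) * S * S + |u y| / 4 := by
    intro t ht
    have h1 := abs_doublePrimitive_sub_mul_le (a := a) hc
      (fun r hr => abs_delay_force_le hε hδ hC hK hM hr) ht
    rw [← he t ht] at h1
    have h2 := mul_le_mul_of_nonneg_right hδS (abs_nonneg (u y))
    linarith
  refine ⟨|u y|, ?_, fun t ht => ⟨hM t ht, hd t ht⟩⟩
  have h3 := hd y hy
  have h4 : |u y| ≤ |u y - a * y| + |a| * S := by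
    have h5 : |a * y| ≤ |a| * S := by
      rw [abs_mul, abs_of_nonneg hy.1]
      exact mul_le_mul_of_nonneg_left hy.2 (abs_nonneg a)
    have h6 := abs_add_le (u y - a * y) (a * y)
    rw [sub_add_cancel] at h6
    linarith
  linarith

/-- Delayed Dirichlet solutions, with slope and size bounded independently of the delay. -/
theorem exists_delay_dirichlet {g k : ℝ → ℝ} {S δ C K : ℝ} (hS : 0 < S)
    (hg : Continuous g) (hk : Continuous k) (hδ : 0 ≤ δ) (hδS : δ * S * S ≤ 1 / 4)
    (hC0 : 0 ≤ C) (hK0 : 0 ≤ K)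
    (hC : ∀ x, |g x| ≤ δ * |x| + C) (hK : ∀ t, |k t| ≤ K) :
    ∃ A M, ∀ ε, 0 < ε → ∃ a ∈ Set.Icc (-A) A, ∃ u : ℝ → ℝ, Continuous u ∧ u S = 0 ∧
      (∀ t ∈ Set.Icc 0 S, |u t| ≤ M) ∧
      ∀ t ∈ Set.Icc 0 S, u t = doublePrimitive a (fun s => k s - g (u (max (s - ε) 0))) t := by
  -- For the slope `A`, `delay_solution_bounds` gives `M ≤ 4 (K + C) S²`, hence
  -- `|u S - A S| ≤ 2 (K + C) S² = A S`; likewise for the slope `-A`.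
  set A := 2 * ((K + C) * S) with hA
  have hA0 : 0 ≤ A := by positivity
  refine ⟨A, 4 / 3 * (A * S + (K + C) * S * S), fun ε hε => ?_⟩
  obtain ⟨u, huc, hu⟩ := exists_delay_family hg hk hε S
  have hcont : ∀ a, Continuous (u a) := fun a => huc.comp (f := fun t : ℝ => (a, t)) (by fun_prop)
  have hb := fun a => delay_solution_bounds hS hε.le hg hk hδ hδS hC hK (hcont a) (hu a)
  have hSS : S ∈ Set.Icc 0 S := ⟨hS.le, le_rfl⟩
  have hpos : 0 ≤ u A S := by
    obtain ⟨M, hM, h⟩ := hb A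
    have := (abs_le.1 (h S hSS).2).1
    rw [abs_of_nonneg hA0] at hM
    have : A * S = 2 * ((K + C) * S * S) := by rw [hA]; ring
    linarith
  have hneg : u (-A) S ≤ 0 := by
    obtain ⟨M, hM, h⟩ := hb (-A)
    have := (abs_le.1 (h S hSS).2).2
    rw [abs_neg, abs_of_nonneg hA0] at hM
    have : A * S = 2 * ((K + C) * S * S) := by rw [hA]; ring
    linarith
  obtain ⟨a, ha, ha0⟩ := intermediate_value_Icc (f := fun a => u a S) (show -A ≤ A by linarith)
    (huc.comp (f := fun a : ℝ => (a, S)) (by fun_prop)).continuousOn ⟨hneg, hpos⟩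
  refine ⟨a, ha, u a, hcont a, ha0, fun t ht => ?_, hu a⟩
  obtain ⟨M, hM, h⟩ := hb a
  have h1 := (h t ht).1
  have h2 : |a| * S ≤ A * S := mul_le_mul_of_nonneg_right (abs_le.2 ha) hS.le
  linarith

theorem tendsto_doublePrimitive {a : ℕ → ℝ} {a' : ℝ} {f : ℕ → ℝ → ℝ} {f' : ℝ → ℝ} {S B t : ℝ}
    (ha : Filter.Tendsto a Filter.atTop (𝓝 a')) (hf : ∀ n, Continuous (f n))
    (hB : ∀ n, ∀ r ∈ Set.Icc 0 S, |f n r| ≤ B)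
    (hlim : ∀ r ∈ Set.Icc 0 S, Filter.Tendsto (fun n => f n r) Filter.atTop (𝓝 (f' r)))
    (ht : t ∈ Set.Icc 0 S) :
    Filter.Tendsto (fun n => doublePrimitive (a n) (f n) t) Filter.atTop
      (𝓝 (doublePrimitive a' f' t)) := by
  obtain ⟨A, hA⟩ := (Metric.isBounded_range_of_tendsto a ha).exists_norm_le
  have h1 : ∀ s ∈ Set.Icc 0 S, Filter.Tendsto (fun n => ∫ r in (0 : ℝ)..s, f n r) Filter.atTop
      (𝓝 (∫ r in (0 : ℝ)..s, f' r)) := by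
    intro s hs
    have hsub : ∀ r ∈ Set.uIoc 0 s, r ∈ Set.Icc 0 S := fun r hr => by
      rw [Set.uIoc_of_le hs.1] at hr
      exact ⟨hr.1.le, hr.2.trans hs.2⟩
    refine intervalIntegral.tendsto_integral_filter_of_dominated_convergence (fun _ => B)
      (Filter.Eventually.of_forall fun n => (hf n).aestronglyMeasurable)
      (Filter.Eventually.of_forall fun n => Filter.Eventually.of_forall fun r hr =>
        hB n r (hsub r hr)) intervalIntegrable_const
      (Filter.Eventually.of_forall fun r hr => hlim r (hsub r hr))
  have hsub : ∀ r ∈ Set.uIoc 0 t, r ∈ Set.Icc 0 S := fun r hr => by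
    rw [Set.uIoc_of_le ht.1] at hr
    exact ⟨hr.1.le, hr.2.trans ht.2⟩
  refine intervalIntegral.tendsto_integral_filter_of_dominated_convergence (fun _ => A + B * S)
    (Filter.Eventually.of_forall fun n =>
      (continuous_const_add_primitive (a n) (hf n)).aestronglyMeasurable)
    (Filter.Eventually.of_forall fun n => Filter.Eventually.of_forall fun r hr =>
      (norm_add_le _ _).trans (add_le_add (hA _ ⟨n, rfl⟩) (abs_primitive_le (hB n) (hsub r hr))))
    intervalIntegrable_const
    (Filter.Eventually.of_forall fun r hr => ha.add (h1 r (hsub r hr)))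

/-- Arzelà-Ascoli for uniformly bounded and uniformly Lipschitz functions on `[0, S]`; pointwise
convergence of the subsequence is all that is recorded. -/
theorem exists_tendsto_of_lipschitz {S M D : ℝ} {u : ℕ → ℝ → ℝ} (hu : ∀ n, Continuous (u n))
    (hM : ∀ n, ∀ t ∈ Set.Icc 0 S, |u n t| ≤ M)
    (hD : ∀ n, ∀ t ∈ Set.Icc 0 S, ∀ t' ∈ Set.Icc 0 S, |u n t - u n t'| ≤ D * |t - t'|) :
    ∃ v : C(Set.Icc (0 : ℝ) S, ℝ), ∃ φ : ℕ → ℕ, StrictMono φ ∧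
      ∀ t : Set.Icc (0 : ℝ) S, Filter.Tendsto (fun n => u (φ n) t) Filter.atTop (𝓝 (v t)) := by
  let w : ℕ → BoundedContinuousFunction (Set.Icc (0 : ℝ) S) ℝ := fun n =>
    BoundedContinuousFunction.mkOfCompact ⟨fun t => u n t, (hu n).comp continuous_subtype_val⟩
  have hcpt : IsCompact (closure (Set.range w)) := by
    refine BoundedContinuousFunction.arzela_ascoli (Set.Icc (-M) M) isCompact_Icc _ ?_ ?_
    · rintro f x ⟨n, rfl⟩
      exact abs_le.1 (hM n x x.2)
    · refine UniformEquicontinuous.equicontinuous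
        (LipschitzWith.uniformEquicontinuous _ (Real.toNNReal D) ?_)
      rintro ⟨_, n, rfl⟩
      refine LipschitzWith.of_dist_le_mul fun x y => ?_
      refine (hD n x x.2 y y.2).trans ?_
      exact mul_le_mul_of_nonneg_right (Real.le_coe_toNNReal D) (abs_nonneg _)
  obtain ⟨v, -, φ, hφ, hv⟩ := hcpt.tendsto_subseq (x := w) fun n => subset_closure ⟨n, rfl⟩
  refine ⟨v.toContinuousMap, φ, hφ, fun t => ?_⟩
  exact ((continuous_eval_const t).tendsto v).comp hv

/-- A solution of `u'' + g u = k` on `[0, S]` with `u 0 = u S = 0`, in integral form. -/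
theorem exists_dirichlet {g k : ℝ → ℝ} {S K : ℝ} (hS : 0 < S) (hg : Continuous g)
    (hgs : Sublinear g) (hk : Continuous k) (hK0 : 0 ≤ K) (hK : ∀ t, |k t| ≤ K) :
    ∃ a, ∃ u : ℝ → ℝ, Continuous u ∧ u S = 0 ∧
      ∀ t ∈ Set.Icc 0 S, u t = doublePrimitive a (fun s => k s - g (u s)) t := by
  obtain ⟨C, hC0, hC⟩ := hgs.exists_abs_le hg (δ := 1 / (4 * S * S)) (by positivity)
  have hδ : 0 ≤ 1 / (4 * S * S) := by positivity
  obtain ⟨A, M, hex⟩ := exists_delay_dirichlet hS hg hk hδ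
    (le_of_eq (by field_simp)) hC0 hK0 hC hK
  set δ := 1 / (4 * S * S)
  have hε : ∀ n : ℕ, (0 : ℝ) < 1 / ((n : ℝ) + 1) := fun n => Nat.one_div_pos_of_nat
  choose a ha u hu huS huM hue using fun n : ℕ => hex _ (hε n)
  have hB := fun n r hr => abs_delay_force_le (r := r) (hε n).le hδ hC hK (huM n) hr
  set f : ℕ → ℝ → ℝ := fun n s => k s - g (u n (max (s - 1 / ((n : ℝ) + 1)) 0)) with hf
  have hfc : ∀ n, Continuous (f n) := fun n => by
    have := hu n
    fun_prop
  set D := A + (K + (δ * M + C)) * S with hDdef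
  have hD : ∀ n, ∀ t ∈ Set.Icc 0 S, ∀ t' ∈ Set.Icc 0 S, |u n t - u n t'| ≤ D * |t - t'| := by
    intro n t ht t' ht'
    rw [hue n t ht, hue n t' ht']
    refine (abs_doublePrimitive_sub_le (hfc n) (hB n) ht ht').trans ?_
    exact mul_le_mul_of_nonneg_right (add_le_add_left (abs_le.2 (ha n)) _) (abs_nonneg _)
  obtain ⟨a', -, ψ, hψ, hψa⟩ := isCompact_Icc.tendsto_subseq ha
  obtain ⟨v, φ, hφ, hv⟩ := exists_tendsto_of_lipschitz (u := fun n => u (ψ n))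
    (fun n => hu _) (fun n => huM _) (fun n => hD _)
  set θ : ℕ → ℕ := fun n => ψ (φ n)
  have hθ : Filter.Tendsto θ Filter.atTop Filter.atTop := (hψ.comp hφ).tendsto_atTop
  set V : ℝ → ℝ := Set.IccExtend hS.le v with hV
  have hVc : Continuous V := v.continuous.Icc_extend'
  have hlim : ∀ t ∈ Set.Icc 0 S, Filter.Tendsto (fun n => u (θ n) t) Filter.atTop (𝓝 (V t)) := by
    intro t ht
    rw [hV, Set.IccExtend_of_mem hS.le v ht]
    exact hv ⟨t, ht⟩
  have hε0 : Filter.Tendsto (fun n => 1 / ((θ n : ℝ) + 1)) Filter.atTop (𝓝 0) :=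
    tendsto_one_div_add_atTop_nhds_zero_nat.comp hθ
  have hlimd : ∀ t ∈ Set.Icc 0 S, Filter.Tendsto
      (fun n => u (θ n) (max (t - 1 / ((θ n : ℝ) + 1)) 0)) Filter.atTop (𝓝 (V t)) := by
    intro t ht
    have h0 : Filter.Tendsto (fun n => D * (1 / ((θ n : ℝ) + 1))) Filter.atTop (𝓝 0) := by
      simpa using hε0.const_mul D
    have hA0 : 0 ≤ D := by
      have h1 := hD 0 S ⟨hS.le, le_rfl⟩ 0 ⟨le_rfl, hS.le⟩
      rw [sub_zero, abs_of_pos hS] at h1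
      exact nonneg_of_mul_nonneg_left ((abs_nonneg _).trans h1) hS
    -- The delay shifts the argument by at most `ε`, hence the value by at most `D * ε`.
    have h2 : Filter.Tendsto (fun n => u (θ n) (max (t - 1 / ((θ n : ℝ) + 1)) 0) - u (θ n) t)
        Filter.atTop (𝓝 0) := by
      refine squeeze_zero_norm (fun n => ?_) h0
      refine (hD (θ n) _ (delay_sub_mem (hε _).le ht) t ht).trans
        (mul_le_mul_of_nonneg_left ?_ hA0)
      have := hε (θ n)
      rw [abs_le]
      refine ⟨by linarith [le_max_left (t - 1 / ((θ n : ℝ) + 1)) 0], ?_⟩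
      have : max (t - 1 / ((θ n : ℝ) + 1)) 0 ≤ t := max_le (by linarith) ht.1
      linarith
    simpa using h2.add (hlim t ht)
  refine ⟨a', V, hVc, ?_, fun t ht => ?_⟩
  · refine tendsto_nhds_unique (hlim S ⟨hS.le, le_rfl⟩) ?_
    simp only [huS]
    exact tendsto_const_nhds
  · refine tendsto_nhds_unique (hlim t ht) ?_
    have := tendsto_doublePrimitive (f' := fun s => k s - g (V s)) (hψa.comp hφ.tendsto_atTop)
      (fun n => hfc (θ n)) (fun n => hB (θ n))
      (fun r hr => tendsto_const_nhds.sub ((hg.tendsto _).comp (hlimd r hr))) ht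
    exact this.congr fun n => (hue (θ n) t ht).symm

/-! ### Odd periodic extension -/

theorem exists_periodic_extension {S : ℝ} (hS : 0 < S) {u : ℝ → ℝ} (hu : Continuous u)
    (h0 : u 0 = 0) (hS0 : u S = 0) :
    ∃ U ∈ oddPeriodic (2 * S), ∀ t ∈ Set.Icc 0 S, U t = u t := by
  -- As `u 0 = 0`, this is the odd function that agrees with `u` on `[0, ∞)`.
  set w : ℝ → ℝ := fun t => u (max t 0) - u (max (-t) 0) with hw
  have hwc : Continuous w := by fun_prop
  have hwo : ∀ t, w (-t) = -w t := fun t => by simp only [hw, neg_neg]; ring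
  have hwS : w S = 0 := by
    simp [hw, max_eq_left hS.le, max_eq_right (neg_nonpos.2 hS.le), hS0, h0]
  have hp : Fact (0 < 2 * S) := ⟨by positivity⟩
  have hend : -S + 2 * S = S := by ring
  have hVc : Continuous (AddCircle.liftIco (2 * S) (-S) w) :=
    AddCircle.liftIco_continuous (by rw [hend, hwo, hwS, neg_zero]) hwc.continuousOn
  set V : ℝ → ℝ := fun t => AddCircle.liftIco (2 * S) (-S) w (t : AddCircle (2 * S)) with hV
  have hVc' : Continuous V := hVc.comp (AddCircle.continuous_mk' _)
  have hVp : Function.Periodic V (2 * S) := fun t => by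
    simp only [hV, AddCircle.coe_add_period]
  have hVw : ∀ t ∈ Set.Icc (-S) S, V t = w t := by
    intro t ht
    rcases eq_or_lt_of_le ht.2 with h | h
    · have h1 := hVp (-S)
      rw [hend] at h1
      rw [h, h1, hwS]
      refine (AddCircle.liftIco_coe_apply ⟨le_rfl, by linarith⟩).trans ?_
      rw [hwo, hwS, neg_zero]
    · exact AddCircle.liftIco_coe_apply ⟨ht.1, by linarith⟩
  -- `V` is already odd; taking its odd part makes oddness hold by construction.
  refine ⟨fun t => (V t - V (-t)) / 2, ⟨by fun_prop, fun t => ?_, fun t => ?_⟩, fun t ht => ?_⟩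
  · have h1 := hVp (-(t + 2 * S))
    rw [show -(t + 2 * S) + 2 * S = -t by ring] at h1
    simp only [hVp t, h1]
  · simp only [neg_neg]
    ring
  · simp only
    rw [hVw t ⟨by linarith [ht.1], ht.2⟩, hVw (-t) ⟨by linarith [ht.2], by linarith [ht.1]⟩, hwo]
    simp only [hw, max_eq_left ht.1, max_eq_right (neg_nonpos.2 ht.1), h0]
    ring

theorem eq_zero_of_deriv_deriv_eq_zero {S : ℝ} (hS : 0 < S) {f f' : ℝ → ℝ}
    (hf : ∀ t, HasDerivAt f (f' t) t) (hf' : ∀ t ∈ Set.Icc 0 S, HasDerivAt f' 0 t)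
    (h0 : f 0 = 0) (hS0 : f S = 0) : ∀ t ∈ Set.Icc 0 S, f t = 0 := by
  have h1 : ∀ t ∈ Set.Icc 0 S, f' t = f' 0 := fun t ht =>
    constant_of_has_deriv_right_zero (fun x hx => (hf' x hx).continuousAt.continuousWithinAt)
      (fun x hx => (hf' x ⟨hx.1, hx.2.le⟩).hasDerivWithinAt) t ht
  have hd : ∀ t ∈ Set.Icc 0 S, HasDerivAt (fun s => f s - f' 0 * s) 0 t := fun t ht => by
    have := (hf t).sub ((hasDerivAt_id t).const_mul (f' 0))
    rwa [h1 t ht, mul_one, sub_self] at this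
  have h2 : ∀ t ∈ Set.Icc 0 S, f t - f' 0 * t = f 0 - f' 0 * 0 := fun t ht =>
    constant_of_has_deriv_right_zero (f := fun s => f s - f' 0 * s)
      (fun x hx => (hd x hx).continuousAt.continuousWithinAt)
      (fun x hx => (hd x ⟨hx.1, hx.2.le⟩).hasDerivWithinAt) t ht
  have h3 := h2 S ⟨hS.le, le_rfl⟩
  rw [hS0, h0] at h3
  have h4 : f' 0 = 0 := (mul_eq_zero.1 (by linarith : f' 0 * S = 0)).resolve_right hS.ne'
  intro t ht
  have := h2 t ht
  rw [h4, h0] at this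
  linarith

theorem eq_of_eqOn_half_period {S : ℝ} (hS : 0 < S) {u v : ℝ → ℝ} (hu : u ∈ oddPeriodic (2 * S))
    (hv : v ∈ oddPeriodic (2 * S)) (h : ∀ t ∈ Set.Icc 0 S, u t = v t) : u = v := by
  have h1 : ∀ t ∈ Set.Ico (-S) (-S + 2 * S), u t = v t := by
    intro t ht
    rcases le_total 0 t with h0 | h0
    · exact h t ⟨h0, by linarith [ht.2]⟩
    · have := h (-t) ⟨by linarith, by linarith [ht.1]⟩
      rw [hu.2.2, hv.2.2] at this
      linarith
  have hp : Function.Periodic (fun t => u t - v t) (2 * S) := hu.2.1.sub hv.2.1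
  funext t
  obtain ⟨y, hy, hty⟩ := hp.exists_mem_Ico (by positivity) t (-S)
  exact sub_eq_zero.1 (hty.trans (sub_eq_zero.2 (h1 y hy)))

theorem oddPeriodic_half_period {S : ℝ} {u : ℝ → ℝ} (hu : u ∈ oddPeriodic (2 * S)) : u S = 0 := by
  have h := hu.2.1 (-S)
  rw [show -S + 2 * S = S by ring, hu.2.2] at h
  linarith

theorem exists_isOddPeriodicSolution {S : ℝ} (hS : 0 < S) {g : ℝ → ℝ} (hgc : Continuous g)
    (hgo : Function.Odd g) (hgs : Sublinear g) {k : ℝ → ℝ} (hk : k ∈ oddPeriodic (2 * S)) :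
    ∃ u, IsOddPeriodicSolution (2 * S) g k u := by
  have hT : 0 < 2 * S := by positivity
  obtain ⟨K, hK0, hK⟩ := hk.2.1.exists_abs_le hT hk.1
  obtain ⟨a, u, huc, huS, hu⟩ := exists_dirichlet hS hgc hgs hk.1 hK0 hK
  have hu0 : u 0 = 0 := by rw [hu 0 ⟨le_rfl, hS.le⟩, doublePrimitive_zero]
  obtain ⟨U, hU, hUu⟩ := exists_periodic_extension hS huc hu0 huS
  obtain ⟨v, hv⟩ := opL_surjective hT (opN g hgc hgo ⟨k, hk⟩ ⟨U, hU⟩)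
  obtain ⟨hd, hd', -⟩ := contDiff_two_data v.2
  set w : ℝ → ℝ := ((v : oddPeriodic (2 * S)) : ℝ → ℝ)
  have hw : w ∈ oddPeriodic (2 * S) := v.1.2
  have hw2 : ∀ t, deriv (deriv w) t = k t - g (U t) := fun t => congrFun (congrArg Subtype.val hv) t
  have hfc : Continuous fun s => k s - g (u s) := hk.1.sub (hgc.comp huc)
  have hUw : U = w := by
    refine eq_of_eqOn_half_period hS hU hw fun t ht => ?_
    rw [hUu t ht, hu t ht]
    refine sub_eq_zero.1 (eq_zero_of_deriv_deriv_eq_zero hS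
      (f := fun t => doublePrimitive a (fun s => k s - g (u s)) t - w t)
      (fun t => (hasDerivAt_doublePrimitive a hfc t).sub (hd t).hasDerivAt) ?_ ?_ ?_ t ht)
    · intro s hs
      have h1 : HasDerivAt (fun t => a + ∫ r in (0 : ℝ)..t, (k r - g (u r))) (k s - g (u s)) s :=
        ((hfc.integral_hasStrictDerivAt 0 s).hasDerivAt).const_add a
      have h2 := h1.sub (hd' s).hasDerivAt
      rwa [hw2 s, hUu s hs, sub_self] at h2
    · rw [doublePrimitive_zero, hw.2.2.map_zero, sub_zero]
    · rw [← hu S ⟨hS.le, le_rfl⟩, huS, oddPeriodic_half_period hw, sub_zero]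
  refine ⟨w, v.2, hw.2.2, hw.2.1, fun t => ?_⟩
  rw [hw2 t, hUw]
  ring

theorem theorem1 (T : ℝ) (hT : 0 < T)
    (g : ℝ → ℝ) (hgc : Continuous g) (hgo : Function.Odd g) (hgs : Sublinear g)
    (k : ℝ → ℝ) (hkc : Continuous k) (hkp : Function.Periodic k T) (hko : Function.Odd k)
    (hkm : ∫ t in (0 : ℝ)..T, k t = 0) :
    (∃ u : ℝ → ℝ, IsOddPeriodicSolution T g k u) ∧
    (∃ R : ℝ, ∀ u : ℝ → ℝ, IsOddPeriodicSolution T g k u → ∀ t, |u t| ≤ R) ∧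
    (∃ R : ℝ, ∀ u ∈ schaeferSet hT g hgc hgo ⟨k, hkc, hkp, hko⟩,
      ∀ t, |(u : ℝ → ℝ) t| ≤ R) := by
  obtain ⟨R, hR⟩ := exists_bound_of_deriv_deriv_eq_smul hT hgc hgs hkc hkp
  refine ⟨?_, ⟨R, fun u hu => ?_⟩, ⟨R, fun u hu => ?_⟩⟩
  · obtain ⟨S, rfl⟩ : ∃ S, T = 2 * S := ⟨T / 2, by ring⟩
    exact exists_isOddPeriodicSolution (by linarith) hgc hgo hgs ⟨hkc, hkp, hko⟩
  · refine hR u hu.contDiff hu.periodic hu.odd 1 ⟨one_pos, le_rfl⟩ fun t => ?_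
    linarith [hu.eqn t]
  · obtain ⟨h2, lam, hlam, he⟩ := deriv_deriv_of_mem_schaeferSet hu
    exact hR u h2 u.2.2.1 u.2.2.2 lam hlam he
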